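/- Let $\vartheta:\mathbb{R}^n\to\mathbb{R}\cup\{\infty\}$ be closed (closed epigraph), proper and convex with $\operatorname{int}(\operatorname{dom}\vartheta)\neq\varnothing$, where $\operatorname{dom}\vartheta=\{x:\vartheta(x)<\infty\}$, and suppose that $\vartheta$ is Legendre, that is, - essentially smooth: $\vartheta$ is differentiable on $\operatorname{int}(\operatorname{dom}\vartheta)$, and $\|\nabla\vartheta(x_k)\|\to\infty$ whenever $(x_k)$ is a sequence in $\operatorname{int}(\operatorname{dom}\vartheta)$ converging to a boundary point of $\operatorname{dom}\vartheta$; and - essentially strictly convex: $\vartheta$ is strictly convex on every convex subset of $\operatorname{dom}(\partial\vartheta)=\{x:\partial\vartheta(x)\neq\varnothing\}$. Let $\epsilon>0$, $\psi=\epsilon\vartheta$, let $\psi^\star(z)=\sup_{x\in\mathbb{R}^n}[x^\top z-\psi(x)]$ be the convex conjugate of $\psi$, and let $C(z)=\operatorname{argmax}_{y\in\operatorname{dom}\psi}[y^\top z-\psi(y)]$ be the mirror map induced by $\psi$. Then: (i) $\psi^\star$ is closed, proper and Legendre (in particular convex, with $\operatorname{int}(\operatorname{dom}\psi^\star)\neq\varnothing$).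 If moreover the maximum defining $C(z)$ is attained for every $z\in\mathbb{R}^n$, or if $\vartheta$ is supercoercive ($\vartheta(x)/\|x\|\to\infty$ as $\|x\|\to\infty$), then $\psi^\star$ is finite-valued on $\mathbb{R}^n$, i.e. $\operatorname{dom}\psi^\star=\mathbb{R}^n$. (ii) $\nabla\psi:\operatorname{int}(\operatorname{dom}\psi)\to\operatorname{int}(\operatorname{dom}\psi^\star)$ is a homeomorphism with inverse $(\nabla\psi)^{-1}=\nabla\psi^\star$. For every $z\in\operatorname{int}(\operatorname{dom}\psi^\star)$ the maximizer defining $C(z)$ exists and is unique, and $\nabla\psi^\star(z)=C(z)$. (iii) $C$ is strictly monotone on $\operatorname{int}(\operatorname{dom}\psi^\star)$: $(C(z)-C(z'))^\top(z-z')>0$ for all $z\neq z'$ in $\operatorname{int}(\operatorname{dom}\psi^\star)$. -/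

import Mathlib

open Set Filter Topology

noncomputable section

namespace ConvexDuality

variable {n : ℕ}

/-- The effective domain of an extended real-valued function. -/
def effDom (f : EuclideanSpace ℝ (Fin n) → EReal) : Set (EuclideanSpace ℝ (Fin n)) :=
  {x | f x < ⊤}

/-- The epigraph, as a subset of `ℝⁿ × ℝ`. -/
def epigraph (f : EuclideanSpace ℝ (Fin n) → EReal) : Set (EuclideanSpace ℝ (Fin n) × ℝ) :=
  {p | f p.1 ≤ (p.2 : EReal)}

/-- `f` is proper: it never takes the value `-∞`, and it is not identically `+∞`. -/
def IsProperFun (f : EuclideanSpace ℝ (Fin n) → EReal) : Prop :=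
  (∀ x, f x ≠ ⊥) ∧ ∃ x, f x < ⊤

/-- `f` is closed: its epigraph is closed. -/
def IsClosedFun (f : EuclideanSpace ℝ (Fin n) → EReal) : Prop :=
  IsClosed (epigraph f)

/-- `f` is convex: its epigraph is convex. -/
def IsConvexFun (f : EuclideanSpace ℝ (Fin n) → EReal) : Prop :=
  Convex ℝ (epigraph f)

/-- `f` is supercoercive: `f x / ‖x‖ → +∞` as `‖x‖ → ∞`. -/
def IsSupercoercive (f : EuclideanSpace ℝ (Fin n) → EReal) : Prop :=
  Tendsto (fun x => f x / ((‖x‖ : ℝ) : EReal))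
    (Bornology.cobounded (EuclideanSpace ℝ (Fin n))) (𝓝 ⊤)

/-- The gradient of an extended real-valued function. It is used only at interior points of the
effective domain of proper functions; near such a point `f` and `fun y => (f y).toReal` agree. -/
def grad (f : EuclideanSpace ℝ (Fin n) → EReal) (x : EuclideanSpace ℝ (Fin n)) :
    EuclideanSpace ℝ (Fin n) :=
  gradient (fun y => (f y).toReal) x

/-- The subdifferential `∂f(x)`. -/
def subdiff (f : EuclideanSpace ℝ (Fin n) → EReal) (x : EuclideanSpace ℝ (Fin n)) :
    Set (EuclideanSpace ℝ (Fin n)) :=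
  {v | ∀ y, f x + ((inner ℝ v (y - x) : ℝ) : EReal) ≤ f y}

/-- The domain of the subdifferential: the points where it is nonempty. -/
def domSubdiff (f : EuclideanSpace ℝ (Fin n) → EReal) : Set (EuclideanSpace ℝ (Fin n)) :=
  {x | (subdiff f x).Nonempty}

/-- Essential smoothness: `int (dom f)` is nonempty, `f` is differentiable there, and the norm of
the gradient tends to infinity along every sequence in `int (dom f)` that converges to a boundary
point of `dom f`. -/
structure IsEssentiallySmooth (f : EuclideanSpace ℝ (Fin n) → EReal) : Prop where
  interior_nonempty : (interior (effDom f)).Nonempty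
  differentiableAt : ∀ x ∈ interior (effDom f), DifferentiableAt ℝ (fun y => (f y).toReal) x
  steep : ∀ (x : ℕ → EuclideanSpace ℝ (Fin n)) (b : EuclideanSpace ℝ (Fin n)),
    (∀ k, x k ∈ interior (effDom f)) → b ∈ frontier (effDom f) → Tendsto x atTop (𝓝 b) →
      Tendsto (fun k => ‖grad f (x k)‖) atTop atTop

/-- Essential strict convexity: `f` is strictly convex on every convex subset of `dom ∂f`
(a proper function is finite on `dom ∂f`). -/
def IsEssentiallyStrictlyConvex (f : EuclideanSpace ℝ (Fin n) → EReal) : Prop :=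
  ∀ S : Set (EuclideanSpace ℝ (Fin n)), S ⊆ domSubdiff f → Convex ℝ S →
    StrictConvexOn ℝ S (fun y => (f y).toReal)

/-- A closed proper convex function with `int (dom f) ≠ ∅` is Legendre if it is essentially smooth
and essentially strictly convex. -/
structure IsLegendre (f : EuclideanSpace ℝ (Fin n) → EReal) : Prop where
  isClosedFun : IsClosedFun f
  isProperFun : IsProperFun f
  isConvexFun : IsConvexFun f
  essentiallySmooth : IsEssentiallySmooth f
  essentiallyStrictlyConvex : IsEssentiallyStrictlyConvex f

/-- The convex conjugate `f⋆(z) = sup_x (⟨x, z⟩ - f x)`. -/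
def conjugate (f : EuclideanSpace ℝ (Fin n) → EReal) (z : EuclideanSpace ℝ (Fin n)) : EReal :=
  ⨆ x : EuclideanSpace ℝ (Fin n), (((inner ℝ x z : ℝ) : EReal) - f x)

/-- The set of maximizers of `y ↦ ⟨y, z⟩ - f y` over `dom f`. -/
def mirrorArgmax (f : EuclideanSpace ℝ (Fin n) → EReal) (z : EuclideanSpace ℝ (Fin n)) :
    Set (EuclideanSpace ℝ (Fin n)) :=
  {x | x ∈ effDom f ∧ ∀ y ∈ effDom f,
    ((inner ℝ y z : ℝ) : EReal) - f y ≤ ((inner ℝ x z : ℝ) : EReal) - f x}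

/-- The mirror map induced by `f`: `z ↦ argmax_{y ∈ dom f} (⟨y, z⟩ - f y)`. It picks an element of
`mirrorArgmax f z` whenever there is one. -/
def mirrorMap (f : EuclideanSpace ℝ (Fin n) → EReal) (z : EuclideanSpace ℝ (Fin n)) :
    EuclideanSpace ℝ (Fin n) :=
  Classical.epsilon (fun x => x ∈ mirrorArgmax f z)

/-- Strict monotonicity of a map on a set. -/
def StrictlyMonotoneOn (F : EuclideanSpace ℝ (Fin n) → EuclideanSpace ℝ (Fin n))
    (S : Set (EuclideanSpace ℝ (Fin n))) : Prop :=
  ∀ z ∈ S, ∀ w ∈ S, z ≠ w → 0 < (inner ℝ (F z - F w) (z - w) : ℝ)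

end ConvexDuality

end

open ConvexDuality

/-! Everything is read off the relation `z ∈ subdiff f x`, which is equality in Fenchel–Young and
says that `x` maximizes `⟨y, z⟩ - f y`. Essential smoothness makes this relation single-valued in
`z`: boundary points carry no subgradient, and at an interior point the gradient is the only one
(`IsEssentiallySmooth.mem_subdiff_iff`).

Strict convexity supplies the local surjectivity `IsLegendre.eventually_exists_mem_subdiff`: after a
small tilt of the tangent plane at `x`, a minimizer of the tilted function survives near `x`. Hence
gradients are interior to `dom f⋆`, and `f⋆` is differentiable there with continuous gradient.
Conversely, a slope interior to `dom f⋆` makes the tilted function coercive, so its minimum is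
attained (`exists_mem_subdiff_of_mem_interior`).

Steepness of `f⋆` comes from the closed graph of the subdifferential, and its strict convexity from
single-valuedness of `∂f`. The two gradients are then mutually inverse. The theorem is this duality
applied to `ψ = ε ϑ`, which inherits the Legendre property. -/

noncomputable section

namespace ConvexDuality

/-! ### Gradient inequalities for real-valued convex functions -/

section RealValued

variable {E : Type*} [NormedAddCommGroup E] [InnerProductSpace ℝ E] [CompleteSpace E]
  {D : Set E} {F : E → ℝ} {x y v : E}

/-- The gradient of a convex function at a point of differentiability is a subgradient. -/
theorem _root_.ConvexOn.add_inner_gradient_le (hF : ConvexOn ℝ D F) (hx : x ∈ D) (hy : y ∈ D)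
    (hd : DifferentiableAt ℝ F x) : F x + inner ℝ (gradient F x) (y - x) ≤ F y := by
  rw [inner_gradient_left]
  have hl : HasDerivAt (fun t : ℝ => x + t • (y - x)) (y - x) 0 := by
    simpa using ((hasDerivAt_id (0 : ℝ)).smul_const (y - x)).const_add x
  have hd' : HasFDerivAt F (fderiv ℝ F x) (x + (0 : ℝ) • (y - x)) := by
    simpa using hd.hasFDerivAt
  have h1 : HasDerivAt (fun t : ℝ => F (x + t • (y - x))) (fderiv ℝ F x (y - x)) 0 :=
    hd'.comp_hasDerivAt (0 : ℝ) hl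
  have h2 := h1.tendsto_slope_zero_right
  have h3 : fderiv ℝ F x (y - x) ≤ F y - F x := by
    refine le_of_tendsto h2 ?_
    filter_upwards [Ioc_mem_nhdsGT (show (0 : ℝ) < 1 by norm_num)] with t ht
    have h4 := hF.2 hx hy (sub_nonneg.2 ht.2) ht.1.le (by ring)
    have h5 : (1 - t) • x + t • y = x + t • (y - x) := by module
    rw [h5] at h4
    simp only [smul_eq_mul, zero_add, zero_smul, add_zero] at h4 ⊢
    rw [inv_mul_le_iff₀ ht.1]
    linarith
  linarith

/-- A subgradient at an interior point of differentiability is the gradient. -/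
theorem eq_gradient_of_forall_add_inner_le (hx : x ∈ interior D) (hd : DifferentiableAt ℝ F x)
    (hv : ∀ y ∈ D, F x + inner ℝ v (y - x) ≤ F y) : v = gradient F x := by
  have hmin : IsLocalMin (fun y => F y - inner ℝ v y) x := by
    filter_upwards [mem_interior_iff_mem_nhds.1 hx] with y hy
    have := hv y hy
    rw [inner_sub_right] at this
    linarith
  have h1 : HasFDerivAt (fun y => F y - inner ℝ v y) (fderiv ℝ F x - innerSL ℝ v) x :=
    hd.hasFDerivAt.sub (innerSL ℝ v).hasFDerivAt
  have h2 := hmin.hasFDerivAt_eq_zero h1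
  refine ext_inner_right ℝ fun w => ?_
  rw [inner_gradient_left]
  have := DFunLike.congr_fun h2 w
  simp only [sub_apply, innerSL_apply_apply, zero_apply]
    at this
  linarith

/-- Strict gradient inequality for a function that is strictly convex on a set. -/
theorem _root_.StrictConvexOn.add_inner_gradient_lt (hF : StrictConvexOn ℝ D F) (hx : x ∈ D)
    (hy : y ∈ D) (hd : DifferentiableAt ℝ F x) (hxy : y ≠ x) :
    F x + inner ℝ (gradient F x) (y - x) < F y := by
  -- Strict convexity at the midpoint, against the non-strict gradient inequality there, yields
  -- strictness at `y`.
  have h1 := hF.2 hx hy hxy.symm (show (0 : ℝ) < 1 / 2 by norm_num)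
    (show (0 : ℝ) < 1 / 2 by norm_num) (by norm_num)
  have hm : (1 / 2 : ℝ) • x + (1 / 2 : ℝ) • y ∈ D :=
    hF.1 hx hy (by norm_num) (by norm_num) (by norm_num)
  have h2 := hF.convexOn.add_inner_gradient_le hx hm hd
  have h3 : (1 / 2 : ℝ) • x + (1 / 2 : ℝ) • y - x = (1 / 2 : ℝ) • (y - x) := by module
  rw [h3, inner_smul_right] at h2
  simp only [smul_eq_mul] at h1
  linarith

/-- A convex function with a subgradient at a point `x` of its domain has bounded gradients on the
segment from `x` to an interior point. -/
theorem exists_norm_gradient_le_of_subgradient [FiniteDimensional ℝ E] (hF : ConvexOn ℝ D F)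
    (hx : x ∈ D) (hv : ∀ y ∈ D, F x + inner ℝ v (y - x) ≤ F y) (hy : y ∈ interior D)
    (hd : ∀ u ∈ interior D, DifferentiableAt ℝ F u) :
    ∃ K : ℝ, ∀ t ∈ Ioc (0 : ℝ) 1, ‖gradient F (x + t • (y - x))‖ ≤ K := by
  obtain ⟨r, hr, hball⟩ : ∃ r > 0, ∀ u, dist u y ≤ r → u ∈ D ∧ F u ≤ F y + 1 := by
    have hc : ContinuousAt F y :=
      hF.continuousOn_interior.continuousAt (isOpen_interior.mem_nhds hy)
    have h1 : ∀ᶠ u in 𝓝 y, u ∈ D ∧ F u ≤ F y + 1 :=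
      Filter.Eventually.and (mem_interior_iff_mem_nhds.1 hy)
        ((hc.eventually (gt_mem_nhds (lt_add_one _))).mono fun _ h => le_of_lt h)
    obtain ⟨r, hr, h⟩ := Metric.nhds_basis_closedBall.eventually_iff.1 h1
    exact ⟨r, hr, fun u hu => h (Metric.mem_closedBall.2 hu)⟩
  -- From `p = x + t(y - x)`, step by `t w` with `w` of length `r` along the gradient `G`. The
  -- endpoint lies on the segment from `x` to `y + w`, so `F p + t r ‖G‖ ≤ (1 - t) F x + t (F y +
  -- 1)`. The subgradient gives `F p ≥ F x - t ‖v‖ ‖y - x‖`; dividing by `t` leaves this bound.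
  refine ⟨(F y + 1 - F x + ‖v‖ * ‖y - x‖) / r, fun t ht => ?_⟩
  have hint : x + t • (y - x) ∈ interior D := hF.1.add_smul_sub_mem_interior hx hy ht
  set p := x + t • (y - x) with hp
  set G := gradient F p with hG
  rcases eq_or_ne G 0 with h0 | h0
  · have := (hball y (by simpa using hr.le)).1
    have h1 := hv y this
    have h2 := neg_le_of_abs_le (abs_real_inner_le_norm v (y - x))
    rw [h0, norm_zero]
    exact div_nonneg (by linarith) hr.le
  have hGn : 0 < ‖G‖ := norm_pos_iff.2 h0
  set w := (r / ‖G‖) • G with hw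
  have hwn : ‖w‖ = r := by
    rw [hw, norm_smul, Real.norm_of_nonneg (by positivity)]; field_simp
  have hu := hball (y + w) (by simp [hwn])
  have hq : (1 - t) • x + t • (y + w) = p + t • w := by rw [hp]; module
  have hqD : p + t • w ∈ D := hq ▸ hF.1 hx hu.1 (sub_nonneg.2 ht.2) ht.1.le (by ring)
  have h1 := hF.2 hx hu.1 (sub_nonneg.2 ht.2) ht.1.le (by ring)
  rw [hq] at h1
  have h2 := hF.add_inner_gradient_le (interior_subset hint) hqD (hd p hint)
  have h3 := hv p (interior_subset hint)
  have h4 : inner ℝ (gradient F p) (p + t • w - p) = t * (r * ‖G‖) := by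
    rw [add_sub_cancel_left, inner_smul_right, hw, inner_smul_right, ← hG,
      real_inner_self_eq_norm_sq]
    field_simp
  have h5 : inner ℝ v (p - x) = t * inner ℝ v (y - x) := by
    rw [hp, add_sub_cancel_left, inner_smul_right]
  have h6 := neg_le_of_abs_le (abs_real_inner_le_norm v (y - x))
  simp only [smul_eq_mul] at h1
  rw [h4] at h2
  rw [h5] at h3
  rw [le_div_iff₀ hr]
  refine le_of_mul_le_mul_left ?_ ht.1
  have h7 : t * F (y + w) ≤ t * (F y + 1) := mul_le_mul_of_nonneg_left hu.2 ht.1.le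
  have h8 := mul_le_mul_of_nonneg_left h6 ht.1.le
  nlinarith

end RealValued

/-! ### Stability of strict tangency under tilting -/

section Tilt

variable {E : Type*} [NormedAddCommGroup E] [InnerProductSpace ℝ E] [FiniteDimensional ℝ E]
  {D : Set E} {F : E → ℝ} {x v : E}

/-- For a convex function that lies strictly above its tangent plane at `x`, a small tilt of the
tangent plane keeps the graph strictly above the plane away from `x`. -/
theorem exists_tilt_lt (hF : ConvexOn ℝ D F) (hx : x ∈ interior D)
    (hs : ∀ y ∈ interior D, y ≠ x → F x + inner ℝ v (y - x) < F y) {r : ℝ} (hr : 0 < r)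
    (hrD : Metric.closedBall x r ⊆ interior D) :
    ∃ δ > 0, ∀ z, ‖z - v‖ < δ → ∀ y ∈ D, r ≤ ‖y - x‖ → F x + inner ℝ z (y - x) < F y := by
  obtain ⟨δ, hδ, hsph⟩ : ∃ δ > 0, ∀ y ∈ Metric.sphere x r, F x + inner ℝ v (y - x) + δ ≤ F y := by
    -- The sphere is empty when the space is trivial.
    rcases (Metric.sphere x r).eq_empty_or_nonempty with he | hne
    · exact ⟨1, one_pos, by simp [he]⟩
    have hsub : Metric.sphere x r ⊆ interior D := Metric.sphere_subset_closedBall.trans hrD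
    have hc : ContinuousOn (fun y => F y - (F x + inner ℝ v (y - x))) (Metric.sphere x r) :=
      (hF.continuousOn_interior.mono hsub).sub (by fun_prop)
    obtain ⟨y₀, hy₀, hmin⟩ := (isCompact_sphere x r).exists_isMinOn hne hc
    refine ⟨F y₀ - (F x + inner ℝ v (y₀ - x)), ?_, fun y hy => ?_⟩
    · have := hs y₀ (hsub hy₀) (Metric.ne_of_mem_sphere hy₀ hr.ne')
      linarith
    · have : F y₀ - (F x + inner ℝ v (y₀ - x)) ≤ F y - (F x + inner ℝ v (y - x)) := hmin hy
      linarith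
  -- On the sphere a tilt moves the plane by at most `‖z - v‖ r`, less than the gap `δ`. Convexity
  -- along the ray from `x` carries the inequality outward.
  refine ⟨δ / r, by positivity, fun z hz y hy hyr => ?_⟩
  have hn : 0 < ‖y - x‖ := hr.trans_le hyr
  set t := r / ‖y - x‖ with ht
  have ht0 : 0 < t := by positivity
  have ht1 : t ≤ 1 := (div_le_one hn).2 hyr
  have htn : t * ‖y - x‖ = r := by rw [ht]; field_simp
  have h1 := hF.2 (interior_subset hx) hy (sub_nonneg.2 ht1) ht0.le (by ring)
  have h2 : (1 - t) • x + t • y = x + t • (y - x) := by module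
  rw [h2] at h1
  have h3 := hsph (x + t • (y - x)) (by
    rw [mem_sphere_iff_norm, add_sub_cancel_left, norm_smul, Real.norm_of_nonneg ht0.le, htn])
  rw [add_sub_cancel_left, inner_smul_right] at h3
  simp only [smul_eq_mul] at h1
  have h4 : inner ℝ (z - v) (y - x) ≤ ‖z - v‖ * ‖y - x‖ := real_inner_le_norm _ _
  rw [inner_sub_left] at h4
  have h5 : t * (‖z - v‖ * ‖y - x‖) < δ := by
    have : ‖z - v‖ * r < δ := by rwa [lt_div_iff₀ hr] at hz
    calc t * (‖z - v‖ * ‖y - x‖) = ‖z - v‖ * (t * ‖y - x‖) := by ring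
      _ < δ := by rwa [htn]
  have h6 := mul_le_mul_of_nonneg_left h4 ht0.le
  refine lt_of_mul_lt_mul_left ?_ ht0.le
  nlinarith

end Tilt

/-! ### Subgradients, Fenchel–Young equality and the conjugate -/

section Bridge

variable {n : ℕ} {f : EuclideanSpace ℝ (Fin n) → EReal} {x y z v : EuclideanSpace ℝ (Fin n)}

theorem IsProperFun.coe_toReal (hf : IsProperFun f) (hx : x ∈ effDom f) :
    ((f x).toReal : EReal) = f x :=
  EReal.coe_toReal (ne_of_lt hx) (hf.1 x)

theorem IsProperFun.nonempty_effDom (hf : IsProperFun f) : (effDom f).Nonempty := hf.2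

theorem mem_effDom_of_le_coe {c : ℝ} (h : f x ≤ c) : x ∈ effDom f :=
  h.trans_lt (EReal.coe_lt_top c)

theorem IsProperFun.le_coe_iff (hf : IsProperFun f) (hx : x ∈ effDom f) {c : ℝ} :
    f x ≤ c ↔ (f x).toReal ≤ c := by
  rw [← hf.coe_toReal hx, EReal.coe_le_coe_iff, EReal.toReal_coe]

theorem IsProperFun.convexOn_toReal (hf : IsProperFun f) (hc : IsConvexFun f) :
    ConvexOn ℝ (effDom f) (fun y => (f y).toReal) := by
  have key : ∀ x ∈ effDom f, ∀ y ∈ effDom f, ∀ a b : ℝ, 0 ≤ a → 0 ≤ b → a + b = 1 →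
      f (a • x + b • y) ≤ ((a * (f x).toReal + b * (f y).toReal : ℝ) : EReal) := by
    intro x hx y hy a b ha hb hab
    exact hc (show (x, (f x).toReal) ∈ epigraph f from (hf.coe_toReal hx).ge)
      (show (y, (f y).toReal) ∈ epigraph f from (hf.coe_toReal hy).ge) ha hb hab
  refine ⟨fun x hx y hy a b ha hb hab => mem_effDom_of_le_coe (key x hx y hy a b ha hb hab),
    fun x hx y hy a b ha hb hab => ?_⟩
  have h := key x hx y hy a b ha hb hab
  exact (hf.le_coe_iff (mem_effDom_of_le_coe h)).1 h

theorem IsProperFun.mem_effDom_of_mem_subdiff (hf : IsProperFun f) (hv : v ∈ subdiff f x) :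
    x ∈ effDom f := by
  obtain ⟨y, hy⟩ := hf.2
  refine (lt_top_iff_ne_top (α := EReal)).2 fun h => ?_
  have := hv y
  rw [h, EReal.top_add_coe] at this
  exact absurd hy (not_lt.2 this)

theorem IsProperFun.mem_subdiff_iff (hf : IsProperFun f) : v ∈ subdiff f x ↔ x ∈ effDom f ∧
    ∀ y ∈ effDom f, (f x).toReal + inner ℝ v (y - x) ≤ (f y).toReal := by
  constructor
  · intro hv
    have hx := hf.mem_effDom_of_mem_subdiff hv
    refine ⟨hx, fun y hy => ?_⟩
    have := hv y
    rw [← hf.coe_toReal hx, ← hf.coe_toReal hy] at this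
    exact_mod_cast this
  · rintro ⟨hx, h⟩ y
    by_cases hy : y ∈ effDom f
    · rw [← hf.coe_toReal hx, ← hf.coe_toReal hy]
      exact_mod_cast h y hy
    · rw [show f y = ⊤ from not_lt_top_iff.1 hy]
      exact le_top

theorem IsProperFun.conjugate_le_coe_iff (hf : IsProperFun f) {c : ℝ} :
    conjugate f z ≤ c ↔ ∀ y ∈ effDom f, inner ℝ y z - (f y).toReal ≤ c := by
  rw [conjugate, iSup_le_iff]
  refine forall_congr' fun y => ?_
  by_cases hy : y ∈ effDom f
  · rw [← hf.coe_toReal hy, EReal.toReal_coe]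
    simp only [hy, true_imp_iff]
    exact_mod_cast Iff.rfl
  · simp [hy, show f y = ⊤ from not_lt_top_iff.1 hy]

theorem IsProperFun.conjugate_ne_bot (hf : IsProperFun f) : conjugate f z ≠ ⊥ := by
  obtain ⟨y, hy⟩ := hf.2
  have h : (((inner ℝ y z : ℝ) : EReal) - f y) ≤ conjugate f z :=
    le_iSup (fun x => ((inner ℝ x z : ℝ) : EReal) - f x) y
  rw [← hf.coe_toReal hy, ← EReal.coe_sub] at h
  exact ne_bot_of_le_ne_bot (EReal.coe_ne_bot _) h

theorem IsProperFun.inner_sub_le_conjugate (hf : IsProperFun f) (hy : y ∈ effDom f)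
    (hz : z ∈ effDom (conjugate f)) :
    inner ℝ y z - (f y).toReal ≤ (conjugate f z).toReal :=
  hf.conjugate_le_coe_iff.1 (EReal.coe_toReal (ne_of_lt hz) hf.conjugate_ne_bot).ge y hy

/-- Rearranged, the subgradient inequality says that the supremum defining the conjugate is attained
at `x`. -/
theorem IsProperFun.conjugate_eq_of_mem_subdiff (hf : IsProperFun f) (hz : z ∈ subdiff f x) :
    conjugate f z = ((inner ℝ x z - (f x).toReal : ℝ) : EReal) := by
  obtain ⟨hx, h⟩ := hf.mem_subdiff_iff.1 hz
  refine le_antisymm (hf.conjugate_le_coe_iff.2 fun y hy => ?_) ?_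
  · have := h y hy
    rw [inner_sub_right, real_inner_comm, real_inner_comm x z] at this
    linarith
  · have := le_iSup (fun x => ((inner ℝ x z : ℝ) : EReal) - f x) x
    rw [EReal.coe_sub, hf.coe_toReal hx]
    exact this

theorem IsProperFun.mem_subdiff_of_conjugate_le (hf : IsProperFun f) (hx : x ∈ effDom f)
    (hz : conjugate f z ≤ ((inner ℝ x z - (f x).toReal : ℝ) : EReal)) : z ∈ subdiff f x := by
  refine hf.mem_subdiff_iff.2 ⟨hx, fun y hy => ?_⟩
  have := hf.conjugate_le_coe_iff.1 hz y hy
  rw [inner_sub_right, real_inner_comm, real_inner_comm x z]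
  linarith

theorem IsProperFun.mem_mirrorArgmax_iff (hf : IsProperFun f) :
    x ∈ mirrorArgmax f z ↔ z ∈ subdiff f x := by
  rw [hf.mem_subdiff_iff]
  refine and_congr_right fun hx => forall₂_congr fun y hy => ?_
  rw [← hf.coe_toReal hx, ← hf.coe_toReal hy, ← EReal.coe_sub, ← EReal.coe_sub,
    EReal.coe_le_coe_iff, EReal.toReal_coe, EReal.toReal_coe, inner_sub_right, real_inner_comm,
    real_inner_comm z x]
  constructor <;> intro h <;> linarith

theorem IsProperFun.mem_effDom_conjugate_of_mem_subdiff (hf : IsProperFun f)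
    (hz : z ∈ subdiff f x) : z ∈ effDom (conjugate f) :=
  mem_effDom_of_le_coe (hf.conjugate_eq_of_mem_subdiff hz).le

/-- A subgradient of `f` at `x` has `x` as a subgradient of the conjugate. -/
theorem IsProperFun.mem_subdiff_conjugate (hf : IsProperFun f) (hz : z ∈ subdiff f x) :
    x ∈ subdiff (conjugate f) z := by
  intro w
  rw [hf.conjugate_eq_of_mem_subdiff hz, ← EReal.coe_add, inner_sub_right]
  have hx := hf.mem_effDom_of_mem_subdiff hz
  have := le_iSup (fun x => ((inner ℝ x w : ℝ) : EReal) - f x) x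
  refine le_trans (le_of_eq ?_) this
  rw [← hf.coe_toReal hx, EReal.toReal_coe, ← EReal.coe_sub]
  congr 1
  ring

/-- The epigraph is an intersection of closed half-spaces, one for each `y`, degenerating to the
empty set or the whole space where `f y` is infinite. -/
theorem isClosedFun_conjugate : IsClosedFun (conjugate f) := by
  have : epigraph (conjugate f) = ⋂ y, {p : EuclideanSpace ℝ (Fin n) × ℝ |
      ((inner ℝ y p.1 : ℝ) : EReal) - f y ≤ (p.2 : EReal)} := by
    ext p
    simp [epigraph, conjugate, iSup_le_iff]
  rw [IsClosedFun, this]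
  refine isClosed_iInter fun y => ?_
  induction f y with
  | bot => simp
  | top => simp
  | coe c =>
    simp only [← EReal.coe_sub, EReal.coe_le_coe_iff]
    exact isClosed_le (by fun_prop) (by fun_prop)

theorem isConvexFun_conjugate : IsConvexFun (conjugate f) := by
  have : epigraph (conjugate f) = ⋂ y, {p : EuclideanSpace ℝ (Fin n) × ℝ |
      ((inner ℝ y p.1 : ℝ) : EReal) - f y ≤ (p.2 : EReal)} := by
    ext p
    simp [epigraph, conjugate, iSup_le_iff]
  rw [IsConvexFun, this]
  refine convex_iInter fun y => ?_
  induction f y with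
  | bot => simpa using convex_empty
  | top => simpa using convex_univ
  | coe c =>
    simp only [← EReal.coe_sub, EReal.coe_le_coe_iff]
    intro p hp q hq a b ha hb hab
    simp only [mem_ofPred_eq, Prod.fst_add, Prod.smul_fst, Prod.snd_add, Prod.smul_snd,
      inner_add_right, inner_smul_right, smul_eq_mul] at hp hq ⊢
    have h1 := mul_le_mul_of_nonneg_left hp ha
    have h2 := mul_le_mul_of_nonneg_left hq hb
    have h3 : a * c + b * c = c := by rw [← add_mul, hab, one_mul]
    linarith

end Bridge

/-! ### Duality for Legendre functions -/

section Legendre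

variable {n : ℕ} {f : EuclideanSpace ℝ (Fin n) → EReal} {x y z v : EuclideanSpace ℝ (Fin n)}

theorem IsProperFun.grad_mem_subdiff (hf : IsProperFun f) (hc : IsConvexFun f)
    (hx : x ∈ interior (effDom f)) (hd : DifferentiableAt ℝ (fun y => (f y).toReal) x) :
    grad f x ∈ subdiff f x :=
  hf.mem_subdiff_iff.2 ⟨interior_subset hx, fun _ hy =>
    (hf.convexOn_toReal hc).add_inner_gradient_le (interior_subset hx) hy hd⟩

/-- The subdifferential of an essentially smooth function is empty outside the interior of the
domain, and reduces to the gradient inside. -/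
theorem IsEssentiallySmooth.mem_subdiff_iff (hs : IsEssentiallySmooth f) (hf : IsProperFun f)
    (hc : IsConvexFun f) : v ∈ subdiff f x ↔ x ∈ interior (effDom f) ∧ v = grad f x := by
  refine ⟨fun hv => ?_, fun ⟨hx, hv⟩ => hv ▸ hf.grad_mem_subdiff hc hx (hs.differentiableAt x hx)⟩
  obtain ⟨hx, hsub⟩ := hf.mem_subdiff_iff.1 hv
  have hF := hf.convexOn_toReal hc
  have hint : x ∈ interior (effDom f) := by
    -- Gradients would stay bounded on a segment running into the boundary point `x`, against
    -- steepness.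
    by_contra hni
    obtain ⟨y, hy⟩ := hs.interior_nonempty
    obtain ⟨K, hK⟩ := exists_norm_gradient_le_of_subgradient hF hx hsub hy hs.differentiableAt
    have hu : ∀ k : ℕ, (1 / ((k : ℝ) + 1)) ∈ Ioc (0 : ℝ) 1 := fun k =>
      ⟨by positivity, (div_le_one (by positivity)).2 (by linarith [k.cast_nonneg (α := ℝ)])⟩
    have hlim : Tendsto (fun k : ℕ => x + (1 / ((k : ℝ) + 1)) • (y - x)) atTop (𝓝 x) := by
      simpa using ((tendsto_one_div_add_atTop_nhds_zero_nat (𝕜 := ℝ)).smul_const (y - x)).const_add x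
    have := hs.steep _ x (fun k => hF.1.add_smul_sub_mem_interior hx hy (hu k))
      ⟨subset_closure hx, hni⟩ hlim
    obtain ⟨k, hk⟩ := (this.eventually_gt_atTop K).exists
    exact absurd (hK _ (hu k)) (not_le.2 hk)
  exact ⟨hint, eq_gradient_of_forall_add_inner_le hint (hs.differentiableAt x hint) hsub⟩

theorem IsLegendre.strictConvexOn_interior (hf : IsLegendre f) :
    StrictConvexOn ℝ (interior (effDom f)) (fun y => (f y).toReal) :=
  hf.essentiallyStrictlyConvex _
    (fun x hx => ⟨_, hf.isProperFun.grad_mem_subdiff hf.isConvexFun hx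
      (hf.essentiallySmooth.differentiableAt x hx)⟩)
    (hf.isProperFun.convexOn_toReal hf.isConvexFun).1.interior

theorem IsLegendre.mem_subdiff_iff (hf : IsLegendre f) :
    v ∈ subdiff f x ↔ x ∈ interior (effDom f) ∧ v = grad f x :=
  hf.essentiallySmooth.mem_subdiff_iff hf.isProperFun hf.isConvexFun

theorem IsLegendre.grad_mem_subdiff (hf : IsLegendre f) (hx : x ∈ interior (effDom f)) :
    grad f x ∈ subdiff f x :=
  hf.mem_subdiff_iff.2 ⟨hx, rfl⟩

/-- The subgradients at points near `x` fill a neighbourhood of the gradient at `x`. -/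
theorem IsLegendre.eventually_exists_mem_subdiff (hf : IsLegendre f)
    (hx : x ∈ interior (effDom f)) {U : Set (EuclideanSpace ℝ (Fin n))} (hU : U ∈ 𝓝 x) :
    ∀ᶠ z in 𝓝 (grad f x), ∃ y ∈ U, z ∈ subdiff f y := by
  have hF := hf.isProperFun.convexOn_toReal hf.isConvexFun
  obtain ⟨r, hr, hball⟩ := Metric.nhds_basis_closedBall.mem_iff.1
    (Filter.inter_mem hU (isOpen_interior.mem_nhds hx))
  obtain ⟨δ, hδ, htilt⟩ := exists_tilt_lt (v := grad f x) hF hx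
    (fun y hy hyx => hf.strictConvexOn_interior.add_inner_gradient_lt hx hy
      (hf.essentiallySmooth.differentiableAt x hx) hyx) hr (hball.trans inter_subset_right)
  filter_upwards [Metric.ball_mem_nhds _ hδ] with z hz
  rw [mem_ball_iff_norm] at hz
  have hcont : ContinuousOn (fun y => (f y).toReal - inner ℝ z y) (Metric.closedBall x r) :=
    (hF.continuousOn_interior.mono (hball.trans inter_subset_right)).sub (by fun_prop)
  -- The minimizer of the tilted function over the ball is global: outside the ball, `htilt` keeps
  -- its values above the one at the centre.
  obtain ⟨y, hy, hmin⟩ := (isCompact_closedBall x r).exists_isMinOn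
    ⟨x, Metric.mem_closedBall_self hr.le⟩ hcont
  refine ⟨y, (hball hy).1, hf.isProperFun.mem_subdiff_iff.2
    ⟨interior_subset (hball hy).2, fun w hw => ?_⟩⟩
  rw [inner_sub_right]
  rcases le_total ‖w - x‖ r with hwr | hwr
  · have : (f y).toReal - inner ℝ z y ≤ (f w).toReal - inner ℝ z w :=
      hmin (mem_closedBall_iff_norm.2 hwr)
    linarith
  · have h1 : (f y).toReal - inner ℝ z y ≤ (f x).toReal - inner ℝ z x :=
      hmin (Metric.mem_closedBall_self hr.le)
    have h2 := htilt z hz w hw hwr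
    rw [inner_sub_right] at h2
    linarith

theorem IsLegendre.grad_mem_interior (hf : IsLegendre f) (hx : x ∈ interior (effDom f)) :
    grad f x ∈ interior (effDom (conjugate f)) := by
  rw [mem_interior_iff_mem_nhds]
  filter_upwards [hf.eventually_exists_mem_subdiff hx univ_mem] with z ⟨y, _, hy⟩
  exact hf.isProperFun.mem_effDom_conjugate_of_mem_subdiff hy

theorem IsLegendre.mem_interior_of_mem_subdiff (hf : IsLegendre f) (hz : z ∈ subdiff f x) :
    z ∈ interior (effDom (conjugate f)) := by
  obtain ⟨hx, rfl⟩ := hf.mem_subdiff_iff.1 hz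
  exact hf.grad_mem_interior hx

theorem IsLegendre.isProperFun_conjugate (hf : IsLegendre f) : IsProperFun (conjugate f) := by
  obtain ⟨x, hx⟩ := hf.essentiallySmooth.interior_nonempty
  have h : grad f x ∈ effDom (conjugate f) := interior_subset (hf.grad_mem_interior hx)
  exact ⟨fun _ => hf.isProperFun.conjugate_ne_bot, _, h⟩

/-- Tilting a closed proper function by an interior point of the domain of its conjugate gives a
function that attains its minimum. -/
theorem exists_mem_subdiff_of_mem_interior (hp : IsProperFun f) (hcl : IsClosedFun f)
    (hpc : IsProperFun (conjugate f)) (hz : z ∈ interior (effDom (conjugate f))) :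
    ∃ x, z ∈ subdiff f x := by
  have hG := hpc.convexOn_toReal isConvexFun_conjugate
  obtain ⟨r, hr, M, hball⟩ : ∃ r > 0, ∃ M : ℝ, ∀ w, ‖w - z‖ ≤ r →
      w ∈ effDom (conjugate f) ∧ (conjugate f w).toReal ≤ M := by
    have hc := hG.continuousOn_interior.continuousAt (isOpen_interior.mem_nhds hz)
    have h1 : ∀ᶠ w in 𝓝 z, w ∈ effDom (conjugate f) ∧
        (conjugate f w).toReal ≤ (conjugate f z).toReal + 1 :=
      Filter.Eventually.and (mem_interior_iff_mem_nhds.1 hz)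
        ((hc.eventually (gt_mem_nhds (lt_add_one _))).mono fun _ h => le_of_lt h)
    obtain ⟨r, hr, h⟩ := Metric.nhds_basis_closedBall.eventually_iff.1 h1
    exact ⟨r, hr, _, fun w hw => h (mem_closedBall_iff_norm.2 hw)⟩
  -- Fenchel–Young at the slope `z + (r / ‖y‖) y`, where the conjugate is at most `M`, gains the
  -- term `r ‖y‖`.
  have hcoer : ∀ y ∈ effDom f, r * ‖y‖ - M ≤ (f y).toReal - inner ℝ y z := by
    intro y hy
    rcases eq_or_ne y 0 with rfl | h0
    · have hb := hball z (by simpa using hr.le)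
      have := hp.inner_sub_le_conjugate hy hb.1
      rw [norm_zero]
      linarith [hb.2]
    · have hn : 0 < ‖y‖ := norm_pos_iff.2 h0
      have hb := hball (z + (r / ‖y‖) • y) (by
        rw [add_sub_cancel_left, norm_smul, Real.norm_of_nonneg (by positivity)]
        field_simp; exact le_rfl)
      have := hp.inner_sub_le_conjugate hy hb.1
      rw [inner_add_right, inner_smul_right, real_inner_self_eq_norm_sq] at this
      have h2 : r / ‖y‖ * ‖y‖ ^ 2 = r * ‖y‖ := by field_simp
      linarith [hb.2]
  obtain ⟨y₀, hy₀⟩ := hp.nonempty_effDom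
  set c := (f y₀).toReal - inner ℝ y₀ z with hc
  -- As `f` is only lower semicontinuous, a continuous linear functional is minimized over a compact
  -- slice of the closed epigraph instead.
  set A := epigraph f ∩ {p | p.2 - inner ℝ p.1 z ≤ c} with hA
  have hAcl : IsClosed A := IsClosed.inter hcl (isClosed_le (by fun_prop) (by fun_prop))
  have hy₀A : (y₀, (f y₀).toReal) ∈ A := ⟨(hp.coe_toReal hy₀).ge, hc.ge⟩
  have hAbd : Bornology.IsBounded A := by
    set R := (c + M) / r
    refine ((Metric.isBounded_closedBall (x := (0 : EuclideanSpace ℝ (Fin n))) (r := R)).prod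
      (Metric.isBounded_Icc (-M - R * ‖z‖) (c + R * ‖z‖))).subset ?_
    rintro ⟨y, t⟩ ⟨h1, h2⟩
    change f y ≤ (t : EReal) at h1
    change t - inner ℝ y z ≤ c at h2
    have hy := mem_effDom_of_le_coe h1
    have h3 := (hp.le_coe_iff hy).1 h1
    have h4 := hcoer y hy
    have h5 : ‖y‖ ≤ R := by
      rw [le_div_iff₀ hr]
      linarith
    have h6 := abs_le.1 (abs_real_inner_le_norm y z)
    have h7 : ‖y‖ * ‖z‖ ≤ R * ‖z‖ := mul_le_mul_of_nonneg_right h5 (norm_nonneg z)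
    have h8 : 0 ≤ r * ‖y‖ := by positivity
    exact ⟨mem_closedBall_zero_iff.2 h5, by constructor <;> linarith [h6.1, h6.2]⟩
  obtain ⟨⟨x, t⟩, ⟨hxt, hxt'⟩, hmin⟩ :=
    (Metric.isCompact_of_isClosed_isBounded hAcl hAbd).exists_isMinOn ⟨_, hy₀A⟩
      (f := fun p => p.2 - inner ℝ p.1 z) (by fun_prop)
  change f x ≤ (t : EReal) at hxt
  change t - inner ℝ x z ≤ c at hxt'
  have hx := mem_effDom_of_le_coe hxt
  have hFx := (hp.le_coe_iff hx).1 hxt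
  refine ⟨x, hp.mem_subdiff_iff.2 ⟨hx, fun y hy => ?_⟩⟩
  rw [inner_sub_right, real_inner_comm, real_inner_comm x z]
  rcases le_total ((f y).toReal - inner ℝ y z) c with h | h
  · have : t - inner ℝ x z ≤ (f y).toReal - inner ℝ y z :=
      hmin (show (y, (f y).toReal) ∈ A from ⟨(hp.coe_toReal hy).ge, h⟩)
    linarith
  · linarith

theorem IsLegendre.exists_mem_subdiff (hf : IsLegendre f)
    (hz : z ∈ interior (effDom (conjugate f))) : ∃ x, z ∈ subdiff f x :=
  exists_mem_subdiff_of_mem_interior hf.isProperFun hf.isClosedFun hf.isProperFun_conjugate hz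

/-- The conjugate of a Legendre function is differentiable at every subgradient `z` of `f`, and its
gradient is the point at which `z` is a subgradient. -/
theorem IsLegendre.hasGradientAt_conjugate (hf : IsLegendre f) (hz : z ∈ subdiff f x) :
    HasGradientAt (fun w => (conjugate f w).toReal) x z := by
  obtain ⟨hx, hzx⟩ := hf.mem_subdiff_iff.1 hz
  have hpc := hf.isProperFun_conjugate
  rw [hasGradientAt_iff_isLittleO, Asymptotics.isLittleO_iff]
  intro c hc
  -- For `w` near `z`, `w` is a subgradient at some `y` within `c` of `x`. The subgradient
  -- inequalities of the conjugate at `z` and `w` trap the first-order remainder between `0` and `⟨y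
  -- - x, w - z⟩ ≤ c ‖w - z‖`.
  have hev := hf.eventually_exists_mem_subdiff hx (Metric.ball_mem_nhds x hc)
  rw [← hzx] at hev
  filter_upwards [hev] with w ⟨y, hyU, hy⟩
  obtain ⟨hzD, h1⟩ := hpc.mem_subdiff_iff.1 (hf.isProperFun.mem_subdiff_conjugate hz)
  obtain ⟨hwD, h2⟩ := hpc.mem_subdiff_iff.1 (hf.isProperFun.mem_subdiff_conjugate hy)
  have h3 := h1 w hwD
  have h4 := h2 z hzD
  have h5 : inner ℝ (y - x) (w - z) ≤ ‖y - x‖ * ‖w - z‖ := real_inner_le_norm _ _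
  have h6 : ‖y - x‖ * ‖w - z‖ ≤ c * ‖w - z‖ :=
    mul_le_mul_of_nonneg_right (mem_ball_iff_norm.1 hyU).le (norm_nonneg _)
  rw [← neg_sub w z, inner_neg_right] at h4
  rw [inner_sub_left] at h5
  rw [Real.norm_of_nonneg (by linarith)]
  linarith

theorem IsLegendre.grad_conjugate_eq (hf : IsLegendre f) (hz : z ∈ subdiff f x) :
    grad (conjugate f) z = x :=
  (hf.hasGradientAt_conjugate hz).gradient

theorem IsLegendre.mem_subdiff_grad_conjugate (hf : IsLegendre f)
    (hz : z ∈ interior (effDom (conjugate f))) : z ∈ subdiff f (grad (conjugate f) z) := by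
  obtain ⟨x, hx⟩ := hf.exists_mem_subdiff hz
  rwa [hf.grad_conjugate_eq hx]

/-- The graph of the subdifferential of a closed proper function is closed. -/
theorem mem_subdiff_of_tendsto (hp : IsProperFun f) (hcl : IsClosedFun f)
    {u w : ℕ → EuclideanSpace ℝ (Fin n)} (h : ∀ k, w k ∈ subdiff f (u k))
    (hu : Tendsto u atTop (𝓝 x)) (hw : Tendsto w atTop (𝓝 z)) : z ∈ subdiff f x := by
  have key : ∀ y ∈ effDom f, f x ≤ (((f y).toReal - inner ℝ z (y - x) : ℝ) : EReal) := by
    intro y hy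
    change (x, (f y).toReal - inner ℝ z (y - x)) ∈ epigraph f
    refine IsClosed.mem_of_tendsto hcl (b := atTop)
      (f := fun k => (u k, (f y).toReal - inner ℝ (w k) (y - u k)))
      (hu.prodMk_nhds (tendsto_const_nhds.sub (hw.inner (tendsto_const_nhds.sub hu)))) ?_
    refine Eventually.of_forall fun k => ?_
    obtain ⟨hk, h1⟩ := hp.mem_subdiff_iff.1 (h k)
    exact (hp.le_coe_iff hk).2 (by linarith [h1 y hy])
  obtain ⟨y₀, hy₀⟩ := hp.nonempty_effDom
  have hx := mem_effDom_of_le_coe (key y₀ hy₀)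
  exact hp.mem_subdiff_iff.2 ⟨hx, fun y hy => by
    linarith [(hp.le_coe_iff hx).1 (key y hy)]⟩

/-- For steepness: were the gradients bounded along a subsequence, a limit point `x` of them would
satisfy `b ∈ subdiff f x` by the closed graph. But subgradients of `f` are interior to the domain of
the conjugate, and `b` is not. -/
theorem IsLegendre.essentiallySmooth_conjugate (hf : IsLegendre f) :
    IsEssentiallySmooth (conjugate f) where
  interior_nonempty := by
    obtain ⟨x, hx⟩ := hf.essentiallySmooth.interior_nonempty
    exact ⟨_, hf.grad_mem_interior hx⟩
  differentiableAt z hz := by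
    obtain ⟨x, hx⟩ := hf.exists_mem_subdiff hz
    exact (hf.hasGradientAt_conjugate hx).differentiableAt
  steep w b hw hb hlim := by
    by_contra hnot
    obtain ⟨K, hK⟩ : ∃ K : ℝ, ∃ᶠ k in atTop, ‖grad (conjugate f) (w k)‖ < K := by
      rw [tendsto_atTop] at hnot
      push Not at hnot
      exact hnot
    obtain ⟨x, -, φ, hφ, hx⟩ := tendsto_subseq_of_frequently_bounded
      (Metric.isBounded_ball (x := (0 : EuclideanSpace ℝ (Fin n))) (r := K))
      (hK.mono fun k hk => mem_ball_zero_iff.2 hk)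
    have hbx : b ∈ subdiff f x := mem_subdiff_of_tendsto hf.isProperFun hf.isClosedFun
      (fun k => hf.mem_subdiff_grad_conjugate (hw (φ k))) hx (hlim.comp hφ.tendsto_atTop)
    exact hb.2 (hf.mem_interior_of_mem_subdiff hbx)

/-- If strictness failed, `w` and `z` would both be subgradients of `f` at `x = grad (conjugate f)
z`, hence both equal to `grad f x`. -/
theorem IsLegendre.add_inner_grad_conjugate_lt (hf : IsLegendre f)
    {w : EuclideanSpace ℝ (Fin n)} (hz : z ∈ interior (effDom (conjugate f)))
    (hw : w ∈ interior (effDom (conjugate f))) (hne : w ≠ z) :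
    (conjugate f z).toReal + inner ℝ (grad (conjugate f) z) (w - z) < (conjugate f w).toReal := by
  have hzx := hf.mem_subdiff_grad_conjugate hz
  set x := grad (conjugate f) z
  by_contra! hle
  refine hne ?_
  have hwx : w ∈ subdiff f x := by
    refine hf.isProperFun.mem_subdiff_of_conjugate_le
      (hf.isProperFun.mem_effDom_of_mem_subdiff hzx) ?_
    rw [hf.isProperFun_conjugate.le_coe_iff (interior_subset hw)]
    rw [hf.isProperFun.conjugate_eq_of_mem_subdiff hzx, EReal.toReal_coe, inner_sub_right] at hle
    linarith
  rw [(hf.mem_subdiff_iff.1 hwx).2, (hf.mem_subdiff_iff.1 hzx).2]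

theorem IsLegendre.essentiallyStrictlyConvex_conjugate (hf : IsLegendre f) :
    IsEssentiallyStrictlyConvex (conjugate f) := by
  intro S hS hSc
  have hSi : S ⊆ interior (effDom (conjugate f)) := fun z hz => by
    obtain ⟨v, hv⟩ := hS hz
    exact ((hf.essentiallySmooth_conjugate.mem_subdiff_iff hf.isProperFun_conjugate
      isConvexFun_conjugate).1 hv).1
  refine ⟨hSc, fun z hz w hw hne a b ha hb hab => ?_⟩
  have hm : a • z + b • w ∈ S := hSc hz hw ha.le hb.le hab
  obtain rfl : a = 1 - b := by linarith
  set m := (1 - b) • z + b • w with hmdef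
  have hzm : z - m = (-b) • (w - z) := by rw [hmdef]; module
  have hwm : w - m = (1 - b) • (w - z) := by rw [hmdef]; module
  have hwz : w - z ≠ 0 := sub_ne_zero.2 hne.symm
  -- In the weighted sum of the gradient inequalities from `m` to the two endpoints, the linear
  -- terms cancel.
  have h1 := hf.add_inner_grad_conjugate_lt (hSi hm) (hSi hz)
    (sub_ne_zero.1 (hzm ▸ smul_ne_zero (neg_ne_zero.2 hb.ne') hwz))
  have h2 := hf.add_inner_grad_conjugate_lt (hSi hm) (hSi hw)
    (sub_ne_zero.1 (hwm ▸ smul_ne_zero ha.ne' hwz))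
  rw [hzm, inner_smul_right] at h1
  rw [hwm, inner_smul_right] at h2
  simp only [smul_eq_mul]
  have h3 := mul_lt_mul_of_pos_left h1 ha
  have h4 := mul_lt_mul_of_pos_left h2 hb
  linarith

/-- The conjugate of a Legendre function is Legendre. -/
theorem IsLegendre.isLegendre_conjugate (hf : IsLegendre f) : IsLegendre (conjugate f) where
  isClosedFun := isClosedFun_conjugate
  isProperFun := hf.isProperFun_conjugate
  isConvexFun := isConvexFun_conjugate
  essentiallySmooth := hf.essentiallySmooth_conjugate
  essentiallyStrictlyConvex := hf.essentiallyStrictlyConvex_conjugate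

/-! ### The gradient homeomorphism and the mirror map -/

theorem IsLegendre.grad_conjugate_mem_interior (hf : IsLegendre f)
    (hz : z ∈ interior (effDom (conjugate f))) :
    grad (conjugate f) z ∈ interior (effDom f) :=
  (hf.mem_subdiff_iff.1 (hf.mem_subdiff_grad_conjugate hz)).1

theorem IsLegendre.grad_grad_conjugate (hf : IsLegendre f)
    (hz : z ∈ interior (effDom (conjugate f))) :
    grad f (grad (conjugate f) z) = z :=
  (hf.mem_subdiff_iff.1 (hf.mem_subdiff_grad_conjugate hz)).2.symm

theorem IsLegendre.grad_conjugate_grad (hf : IsLegendre f) (hx : x ∈ interior (effDom f)) :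
    grad (conjugate f) (grad f x) = x :=
  hf.grad_conjugate_eq (hf.grad_mem_subdiff hx)

theorem IsLegendre.continuousAt_grad_conjugate (hf : IsLegendre f)
    (hz : z ∈ interior (effDom (conjugate f))) :
    ContinuousAt (grad (conjugate f)) z := by
  refine tendsto_def.2 fun U hU => ?_
  have := hf.eventually_exists_mem_subdiff (hf.grad_conjugate_mem_interior hz) hU
  rw [hf.grad_grad_conjugate hz] at this
  filter_upwards [this] with w ⟨y, hyU, hy⟩
  rwa [mem_preimage, hf.grad_conjugate_eq hy]

/-- Local surjectivity is applied to the conjugate, itself Legendre; since the two gradients are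
already known to be mutually inverse, the biconjugate identity is not needed. -/
theorem IsLegendre.continuousAt_grad (hf : IsLegendre f) (hx : x ∈ interior (effDom f)) :
    ContinuousAt (grad f) x := by
  refine tendsto_def.2 fun U hU => ?_
  have := hf.isLegendre_conjugate.eventually_exists_mem_subdiff (hf.grad_mem_interior hx) hU
  rw [hf.grad_conjugate_grad hx] at this
  filter_upwards [this] with y ⟨w, hwU, hw⟩
  obtain ⟨hwi, rfl⟩ := hf.isLegendre_conjugate.mem_subdiff_iff.1 hw
  rwa [mem_preimage, hf.grad_grad_conjugate hwi]

/-- The gradient of a Legendre function as a homeomorphism onto the interior of the domain of the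
conjugate. -/
def IsLegendre.gradHomeomorph (hf : IsLegendre f) :
    interior (effDom f) ≃ₜ interior (effDom (conjugate f)) where
  toFun x := ⟨grad f x, hf.grad_mem_interior x.2⟩
  invFun z := ⟨grad (conjugate f) z, hf.grad_conjugate_mem_interior z.2⟩
  left_inv x := Subtype.ext (hf.grad_conjugate_grad x.2)
  right_inv z := Subtype.ext (hf.grad_grad_conjugate z.2)
  continuous_toFun := Continuous.subtype_mk (continuous_iff_continuousAt.2 fun x =>
    (hf.continuousAt_grad x.2).comp continuousAt_subtype_val) _
  continuous_invFun := Continuous.subtype_mk (continuous_iff_continuousAt.2 fun z =>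
    (hf.continuousAt_grad_conjugate z.2).comp continuousAt_subtype_val) _

theorem IsLegendre.mirrorArgmax_eq (hf : IsLegendre f)
    (hz : z ∈ interior (effDom (conjugate f))) :
    mirrorArgmax f z = {grad (conjugate f) z} := by
  ext x
  rw [hf.isProperFun.mem_mirrorArgmax_iff, mem_singleton_iff]
  exact ⟨fun h => (hf.grad_conjugate_eq h).symm, fun h => h ▸ hf.mem_subdiff_grad_conjugate hz⟩

theorem IsLegendre.mirrorMap_eq (hf : IsLegendre f)
    (hz : z ∈ interior (effDom (conjugate f))) :
    mirrorMap f z = grad (conjugate f) z := by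
  have h : mirrorMap f z ∈ mirrorArgmax f z :=
    Classical.epsilon_spec (p := fun x => x ∈ mirrorArgmax f z)
      ⟨_, (hf.mirrorArgmax_eq hz).ge rfl⟩
  rwa [hf.mirrorArgmax_eq hz] at h

theorem IsLegendre.strictlyMonotoneOn_mirrorMap (hf : IsLegendre f) :
    StrictlyMonotoneOn (mirrorMap f) (interior (effDom (conjugate f))) := by
  intro z hz w hw hne
  rw [hf.mirrorMap_eq hz, hf.mirrorMap_eq hw]
  have h1 := hf.add_inner_grad_conjugate_lt hz hw hne.symm
  have h2 := hf.add_inner_grad_conjugate_lt hw hz hne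
  rw [← neg_sub z w, inner_neg_right] at h1
  rw [inner_sub_left]
  linarith

end Legendre

/-! ### Positive multiples and finiteness of the conjugate -/

section Scaling

variable {n : ℕ} {f g : EuclideanSpace ℝ (Fin n) → EReal} {ε : ℝ}

theorem effDom_eq_of_eq_mul (hε : 0 < ε) (hg : ∀ x, g x = (ε : EReal) * f x) :
    effDom g = effDom f := by
  ext x
  simp only [effDom, mem_ofPred_eq, hg]
  induction f x with
  | bot => simp [EReal.coe_mul_bot_of_pos hε]
  | top => simp [EReal.coe_mul_top_of_pos hε]
  | coe c => simp [← EReal.coe_mul, EReal.coe_lt_top]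

theorem mul_le_coe_mul_iff (hε : 0 < ε) {a : EReal} {c : ℝ} :
    (ε : EReal) * a ≤ ((ε * c : ℝ) : EReal) ↔ a ≤ c := by
  induction a with
  | bot => simp [EReal.coe_mul_bot_of_pos hε]
  | top => simp [EReal.coe_mul_top_of_pos hε, -EReal.coe_mul]
  | coe b =>
    rw [← EReal.coe_mul, EReal.coe_le_coe_iff, EReal.coe_le_coe_iff, mul_le_mul_iff_right₀ hε]

/-- As a linear preimage, the scaled epigraph inherits closedness and convexity. -/
theorem epigraph_eq_preimage_of_eq_mul (hε : 0 < ε) (hg : ∀ x, g x = (ε : EReal) * f x) :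
    epigraph g = (LinearMap.prodMap LinearMap.id (ε⁻¹ • LinearMap.id) :
      EuclideanSpace ℝ (Fin n) × ℝ →ₗ[ℝ] EuclideanSpace ℝ (Fin n) × ℝ) ⁻¹' epigraph f := by
  ext ⟨x, t⟩
  simp only [epigraph, mem_ofPred_eq, mem_preimage, LinearMap.prodMap_apply, LinearMap.id_apply,
    LinearMap.smul_apply, smul_eq_mul, hg]
  rw [← mul_le_coe_mul_iff hε (a := f x), mul_inv_cancel_left₀ hε.ne']

/-- A positive multiple of a Legendre function is Legendre. -/
theorem IsLegendre.of_eq_mul (hf : IsLegendre f) (hε : 0 < ε)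
    (hg : ∀ x, g x = (ε : EReal) * f x) : IsLegendre g := by
  have hdom := effDom_eq_of_eq_mul hε hg
  have hepi := epigraph_eq_preimage_of_eq_mul hε hg
  have hreal : (fun y => (g y).toReal) = fun y => ε * (f y).toReal := by
    funext y
    rw [hg, EReal.toReal_mul, EReal.toReal_coe]
  have hp : IsProperFun g := by
    refine ⟨fun x => ?_, ?_⟩
    · rw [hg]
      have := hf.isProperFun.1 x
      revert this
      induction f x with
      | bot => simp
      | top => simp [EReal.coe_mul_top_of_pos hε]
      | coe c => intro _; rw [← EReal.coe_mul]; exact EReal.coe_ne_bot _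
    · obtain ⟨x, hx⟩ := hf.isProperFun.nonempty_effDom
      exact ⟨x, hdom.ge hx⟩
  have hgrad : ∀ x ∈ interior (effDom f), grad g x = ε • grad f x := by
    intro x hx
    have hd := (hf.essentiallySmooth.differentiableAt x hx).hasGradientAt
    refine HasGradientAt.gradient ?_
    rw [hreal, hasGradientAt_iff_hasFDerivAt, map_smul]
    exact (hasGradientAt_iff_hasFDerivAt.1 hd).const_mul ε
  refine ⟨?_, hp, ?_, ⟨?_, ?_, ?_⟩, ?_⟩
  · rw [IsClosedFun, hepi]
    exact hf.isClosedFun.preimage (LinearMap.continuous_of_finiteDimensional _)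
  · rw [IsConvexFun, hepi]
    exact hf.isConvexFun.linear_preimage _
  · rw [hdom]
    exact hf.essentiallySmooth.interior_nonempty
  · intro x hx
    rw [hreal]
    exact (hf.essentiallySmooth.differentiableAt x (hdom ▸ hx)).const_mul ε
  · intro u b hu hb hlim
    rw [hdom] at hu hb
    have := (hf.essentiallySmooth.steep u b hu hb hlim).const_mul_atTop hε
    refine this.congr fun k => ?_
    rw [hgrad _ (hu k), norm_smul, Real.norm_of_nonneg hε.le]
  · intro S hS hSc
    have hS' : S ⊆ domSubdiff f := by
      intro x hx
      obtain ⟨v, hv⟩ := hS hx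
      obtain ⟨hxD, h⟩ := hp.mem_subdiff_iff.1 hv
      refine ⟨ε⁻¹ • v, hf.isProperFun.mem_subdiff_iff.2 ⟨hdom ▸ hxD, fun y hy => ?_⟩⟩
      have h1 := h y (hdom.symm ▸ hy)
      have h2 : ∀ y, (g y).toReal = ε * (f y).toReal := fun y => congrFun hreal y
      rw [h2, h2] at h1
      rw [real_inner_smul_left]
      refine le_of_mul_le_mul_left ?_ hε
      rwa [mul_add, mul_inv_cancel_left₀ hε.ne']
    have := hf.essentiallyStrictlyConvex S hS' hSc
    rw [hreal]
    refine ⟨hSc, fun x hx y hy hxy a b ha hb hab => ?_⟩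
    have h1 := mul_lt_mul_of_pos_left (this.2 hx hy hxy ha hb hab) hε
    simp only [smul_eq_mul] at h1 ⊢
    linarith

theorem effDom_conjugate_eq_univ_of_mirrorArgmax (hg : IsProperFun g)
    (h : ∀ z, (mirrorArgmax g z).Nonempty) : effDom (conjugate g) = univ := by
  refine eq_univ_of_forall fun z => ?_
  obtain ⟨x, hx⟩ := h z
  exact hg.mem_effDom_conjugate_of_mem_subdiff (hg.mem_mirrorArgmax_iff.1 hx)

theorem IsLegendre.effDom_conjugate_eq_univ_of_supercoercive (hgl : IsLegendre g) (hε : 0 < ε)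
    (hg : ∀ x, g x = (ε : EReal) * f x) (hs : IsSupercoercive f) :
    effDom (conjugate g) = univ := by
  have hp := hgl.isProperFun
  refine eq_univ_of_forall fun z => ?_
  obtain ⟨x₀, hx₀⟩ := hgl.essentiallySmooth.interior_nonempty
  obtain ⟨-, hv⟩ := hp.mem_subdiff_iff.1 (hgl.grad_mem_subdiff hx₀)
  set v := grad g x₀
  -- Beyond slope `‖z‖ / ε`, `g x` exceeds `‖x‖ ‖z‖`, so `⟨x, z⟩ - g x` is negative far out.
  have h1 : ∀ᶠ x in Bornology.cobounded (EuclideanSpace ℝ (Fin n)),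
      ((‖z‖ / ε : ℝ) : EReal) < f x / ((‖x‖ : ℝ) : EReal) :=
    hs.eventually (lt_mem_nhds (EReal.coe_lt_top _))
  obtain ⟨R, -, hR⟩ := (Metric.hasBasis_cobounded_compl_closedBall
    (0 : EuclideanSpace ℝ (Fin n))).eventually_iff.1 h1
  set R' := max R 0
  -- Inside the ball of radius `R'` the bound comes from the affine minorant of `g` with slope `v`;
  -- the absolute value makes the constant nonnegative, which serves the points outside.
  refine mem_effDom_of_le_coe (c := |R' * ‖z - v‖ + inner ℝ v x₀ - (g x₀).toReal|)
    (hp.conjugate_le_coe_iff.2 fun y hy => ?_)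
  rcases le_or_gt ‖y‖ R' with hyR | hyR
  · refine le_trans ?_ (le_abs_self _)
    have h2 := hv y hy
    have h3 : inner ℝ y (z - v) ≤ ‖y‖ * ‖z - v‖ := real_inner_le_norm _ _
    have h4 : ‖y‖ * ‖z - v‖ ≤ R' * ‖z - v‖ := mul_le_mul_of_nonneg_right hyR (norm_nonneg _)
    rw [inner_sub_right, real_inner_comm] at h2
    rw [inner_sub_right] at h3
    linarith
  · refine le_trans ?_ (abs_nonneg _)
    have hn : 0 < ‖y‖ := (le_max_right _ _).trans_lt hyR
    have h2 := hR (x := y) (by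
      simpa using (le_max_left R 0).trans_lt hyR)
    have hyf : y ∈ effDom f := effDom_eq_of_eq_mul hε hg ▸ hy
    have hgy : (g y).toReal = ε * (f y).toReal := by
      rw [hg, EReal.toReal_mul, EReal.toReal_coe]
    have hfb : f y ≠ ⊥ := fun hb => hp.1 y (by rw [hg, hb, EReal.coe_mul_bot_of_pos hε])
    rw [← EReal.coe_toReal (ne_of_lt hyf) hfb, ← EReal.coe_div, EReal.coe_lt_coe_iff,
      div_lt_div_iff₀ hε hn] at h2
    have h3 : inner ℝ y z ≤ ‖y‖ * ‖z‖ := real_inner_le_norm _ _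
    rw [hgy]
    linarith

end Scaling

end ConvexDuality

end

theorem mainTheorem5 {n : ℕ} (ϑ ψ : EuclideanSpace ℝ (Fin n) → EReal) (ε : ℝ) (hε : 0 < ε)
    (hϑ : IsLegendre ϑ) (hψ : ∀ x, ψ x = (ε : EReal) * ϑ x) :
    -- (i)
    (IsClosedFun (conjugate ψ) ∧ IsProperFun (conjugate ψ) ∧ IsLegendre (conjugate ψ) ∧
      ((IsSupercoercive ϑ ∨ ∀ z, (mirrorArgmax ψ z).Nonempty) →
        effDom (conjugate ψ) = Set.univ)) ∧
    -- (ii)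
    (∃ e : interior (effDom ψ) ≃ₜ interior (effDom (conjugate ψ)),
      (∀ x : interior (effDom ψ),
        (e x : EuclideanSpace ℝ (Fin n)) = grad ψ (x : EuclideanSpace ℝ (Fin n))) ∧
      (∀ z : interior (effDom (conjugate ψ)),
        (e.symm z : EuclideanSpace ℝ (Fin n)) =
          grad (conjugate ψ) (z : EuclideanSpace ℝ (Fin n)))) ∧
    (∀ z ∈ interior (effDom (conjugate ψ)),
      mirrorArgmax ψ z = {mirrorMap ψ z} ∧ grad (conjugate ψ) z = mirrorMap ψ z) ∧
    -- (iii)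
    StrictlyMonotoneOn (mirrorMap ψ) (interior (effDom (conjugate ψ))) := by
  have hL : IsLegendre ψ := hϑ.of_eq_mul hε hψ
  refine ⟨⟨isClosedFun_conjugate, hL.isProperFun_conjugate, hL.isLegendre_conjugate, ?_⟩,
    ⟨hL.gradHomeomorph, fun _ => rfl, fun _ => rfl⟩, fun z hz => ?_,
    hL.strictlyMonotoneOn_mirrorMap⟩
  · rintro (h | h)
    · exact hL.effDom_conjugate_eq_univ_of_supercoercive hε hψ h
    · exact effDom_conjugate_eq_univ_of_mirrorArgmax hL.isProperFun h
  · rw [hL.mirrorMap_eq hz]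
    exact ⟨hL.mirrorArgmax_eq hz, rfl⟩
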